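/- For $n\ge 1$, $p\in(0,1)$ and a family $\mathcal F\subset 2^{[n]}$ of subsets of $[n]=\{1,\dots,n\}$ let $$\mu_p(\mathcal F)=\sum_{F\in\mathcal F}p^{|F|}(1-p)^{n-|F|}.$$ Families $\mathcal F,\mathcal G\subset 2^{[n]}$ are called cross-intersecting if $F\cap G\ne\emptyset$ for all $F\in\mathcal F$ and $G\in\mathcal G$. For $j\ge 0$ and $n\ge j+2$ let $$\mathcal A_j=\{A\subset[n]:1\in A\}\sqcup\{A\subset[n]:A\cap[j+2]=[j+2]\setminus\{1\}\},$$ $$\mathcal B_j=\{B\subset[n]:1\in B\}\setminus\{B\subset[n]:B\cap[j+2]=\{1\}\};$$ the values $\mu_p(\mathcal A_j)$ and $\mu_p(\mathcal B_j)$ do not depend on the choice of $n\ge j+2$. **Theorem.** Let $\alpha,\beta$ be real numbers with $\alpha>0$, $\beta>\frac12$ and $\alpha+\beta<1$. Suppose that $\mu_\alpha(\mathcal A_j)\,\mu_\beta(\mathcal B_j)<\alpha\beta$ for every integer $j\ge 0$. Then, for every $n\ge 1$, $$\max\{\mu_\alpha(\mathcal F)\,\mu_\beta(\mathcal G):\ \mathcal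 F,\mathcal G\subset 2^{[n]}\text{ cross-intersecting}\}=\alpha\beta.$$ -/

import Mathlib

/-- Families of subsets of `[n]` are modelled as `Finset (Finset (Fin n))`; the element `i + 1`
of `[n]` corresponds to `i : Fin n`, so that `1 ∈ [n]` corresponds to `0`.
Two families are cross-intersecting if every member of one meets every member of the other. -/
def CrossIntersecting {n : ℕ} (F G : Finset (Finset (Fin n))) : Prop :=
  ∀ A ∈ F, ∀ B ∈ G, (A ∩ B).Nonempty

/-- The `p`-biased measure of a family of subsets of `[n]`. -/
noncomputable def biasedMeasure {n : ℕ} (p : ℝ) (F : Finset (Finset (Fin n))) : ℝ :=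
  ∑ A ∈ F, p ^ A.card * (1 - p) ^ (n - A.card)

/-- The initial segment `[m]` of `[n]` (its first `m` elements, when `m ≤ n`). -/
def initSegment (n m : ℕ) : Finset (Fin n) :=
  {i | i.val < m}

/-- The modified star `A_j` on `[n]` (meant for `j + 2 ≤ n`). -/
def modifiedStarA (n j : ℕ) [NeZero n] : Finset (Finset (Fin n)) :=
  (Finset.univ.filter fun A => 0 ∈ A) ∪
    (Finset.univ.filter fun A => A ∩ initSegment n (j + 2) = initSegment n (j + 2) \ {0})

/-- The modified star `B_j` on `[n]` (meant for `j + 2 ≤ n`). -/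
def modifiedStarB (n j : ℕ) [NeZero n] : Finset (Finset (Fin n)) :=
  (Finset.univ.filter fun B => 0 ∈ B) \
    (Finset.univ.filter fun B => B ∩ initSegment n (j + 2) = {0})

/-- The open triangle `Ω`. -/
def triangleOmega : Set (ℝ × ℝ) :=
  {q | 0 < q.1 ∧ 1 / 2 < q.2 ∧ q.1 + q.2 < 1}

/-- All values `μ_α(F) μ_β(G)` for cross-intersecting families `F`, `G` of subsets of `[n]`. -/
def crossProducts (n : ℕ) (α β : ℝ) : Set ℝ :=
  {x | ∃ F G : Finset (Finset (Fin n)),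
    CrossIntersecting F G ∧ x = biasedMeasure α F * biasedMeasure β G}

/-! A pair of equal stars attains `α * β`. For the bound put `b = 1 - β`, so that `α < b < 1/2`, and
let `U` be the up-closure of `F`. The complement of a member of `G` is never in `U`, hence `μ_β(G) ≤
1 - μ_b(U)`, and it suffices that `μ_α(U) (1 - μ_b(U)) ≤ α (1 - b)`. The model case is `U` an
initial segment of the lexicographic order; the families `A_j` are such segments. For general
monotone `U`, any `f` fixing 0 and 1 and obeying the two-point inequality gives `μ_α(U) ≤ f
(μ_b(U))`, by induction on the dimension (`IsLexProfile.biasedSum_le`). The odds-ratio profile is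
one such `f`, but is too weak when `μ_b(U) > b`. Applying `lexStep` to it keeps all the conditions
of `IsLexProfile` (`isLexProfile_iterate`) and makes the bound exact at the segments `A_j`. Between
consecutive `A_j` the product inequality follows from its two ends (`block_inequality`), where it is
the hypothesis on `A_j` and `B_j`. -/

/-- The properties of the function sending the `b`-measure of an initial segment of the
lexicographic order on the cube to its `a`-measure that are preserved by refining the cube by one
coordinate: superadditivity on the circle, the behaviour under rescaling by the odds `b / (1 - b)`
at both ends of the unit interval, and the two-point inequality that drives induction on the
dimension of the cube. -/
structure IsLexProfile (a b : ℝ) (f : ℝ → ℝ) : Prop where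
  map_zero : f 0 = 0
  map_one : f 1 = 1
  add_le : ∀ x y, 0 ≤ x → 0 ≤ y → x + y ≤ 1 → f x + f y ≤ f (x + y)
  add_le_wrap : ∀ x y, x ≤ 1 → y ≤ 1 → 1 ≤ x + y → f x + f y ≤ 1 + f (x + y - 1)
  scale_le : ∀ w, 0 ≤ w → w ≤ 1 → a / (1 - a) * f w ≤ f (b / (1 - b) * w)
  compl_scale_le : ∀ d, 0 ≤ d → d ≤ 1 →
    a / (1 - a) * (1 - f (1 - d)) ≤ 1 - f (1 - b / (1 - b) * d)
  two_point : ∀ x y, 0 ≤ x → x ≤ y → y ≤ 1 →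
    (1 - a) * f x + a * f y ≤ f ((1 - b) * x + b * y)

/-- Prepending one coordinate to the lexicographic order. -/
noncomputable def lexStep (a b : ℝ) (f : ℝ → ℝ) (t : ℝ) : ℝ :=
  if t ≤ b then a * f (t / b) else a + (1 - a) * f ((t - b) / (1 - b))

/-- The largest `a`-measure that a monotone family of `b`-measure `x` can have according to the
odds-ratio inequality. -/
noncomputable def oddsProfile (a b x : ℝ) : ℝ :=
  a * (1 - b) * x / (b * (1 - a) - (b - a) * x)

lemma lexStep_mul {a b : ℝ} (hb : 0 < b) (f : ℝ → ℝ) {t : ℝ} (ht : t ≤ 1) :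
    lexStep a b f (b * t) = a * f t := by
  have h : b * t ≤ b := by nlinarith
  rw [lexStep, if_pos h, mul_div_cancel_left₀ _ hb.ne']

lemma lexStep_add {a b : ℝ} (hb : 0 < b) (hb1 : b < 1) {f : ℝ → ℝ} (h0 : f 0 = 0) (h1 : f 1 = 1)
    {t : ℝ} (ht : 0 ≤ t) : lexStep a b f (b + (1 - b) * t) = a + (1 - a) * f t := by
  rcases ht.eq_or_lt with rfl | ht
  · have := lexStep_mul (a := a) hb f le_rfl
    simpa [h0, h1] using this
  · have h : ¬ b + (1 - b) * t ≤ b := by nlinarith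
    rw [lexStep, if_neg h, add_sub_cancel_left, mul_div_cancel_left₀ _ (by linarith)]

lemma exists_lex_split {b : ℝ} (hb : 0 < b) (hb1 : b < 1) {x : ℝ} (h0 : 0 ≤ x) (h1 : x ≤ 1) :
    (∃ t, 0 ≤ t ∧ t ≤ 1 ∧ x = b * t) ∨ (∃ t, 0 ≤ t ∧ t ≤ 1 ∧ x = b + (1 - b) * t) := by
  have hb' : 0 < 1 - b := by linarith
  rcases le_total x b with h | h
  · exact .inl ⟨x / b, by positivity, (div_le_one hb).2 h, by field_simp⟩
  · refine .inr ⟨(x - b) / (1 - b), div_nonneg (by linarith) hb'.le,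
      (div_le_one hb').2 (by linarith), ?_⟩
    field_simp; ring

/-! ### Prepending a coordinate preserves lexicographic profiles. -/

namespace IsLexProfile

variable {a b : ℝ} {f : ℝ → ℝ}

lemma lexStep_add_le (hf : IsLexProfile a b f) (ha : 0 < a) (hab : a < b) (hb : b < 1 / 2)
    {x y : ℝ} (hx : 0 ≤ x) (hxy : x ≤ y) (hs : x + y ≤ 1) :
    lexStep a b f x + lexStep a b f y ≤ lexStep a b f (x + y) := by
  have hb0 : 0 < b := ha.trans hab
  have hb1 : b < 1 := by linarith
  have ha' : 0 < 1 - a := by linarith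
  have hb' : 0 < 1 - b := by linarith
  obtain ⟨θ, hθ⟩ : ∃ θ, b / (1 - b) = θ := ⟨_, rfl⟩
  obtain ⟨κ, hκ⟩ : ∃ κ, a / (1 - a) = κ := ⟨_, rfl⟩
  have hP := hf.scale_le
  rw [hθ, hκ] at hP
  have hθb : θ * (1 - b) = b := by rw [← hθ]; field_simp
  have hκa : κ * (1 - a) = a := by rw [← hκ]; field_simp
  have hθ0 : 0 < θ := hθ ▸ div_pos hb0 hb'
  have hθ1 : θ < 1 := by rw [← hθ, div_lt_one hb']; linarith
  have hκθ := hP 1 zero_le_one le_rfl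
  rw [hf.map_one, mul_one, mul_one] at hκθ
  rcases exists_lex_split hb0 hb1 (by linarith : 0 ≤ y) (by linarith) with
    ⟨v, hv0, hv1, rfl⟩ | ⟨v, hv0, hv1, rfl⟩ <;>
  rcases exists_lex_split hb0 hb1 hx (by linarith) with
    ⟨u, hu0, hu1, rfl⟩ | ⟨u, hu0, hu1, rfl⟩
  · rw [lexStep_mul hb0 f hu1, lexStep_mul hb0 f hv1, ← mul_add b]
    rcases le_total (u + v) 1 with h | h
    · rw [lexStep_mul hb0 f h]
      nlinarith [hf.add_le u v hu0 hv0 h]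
    -- The sum passes the breakpoint `b`. Its excess, `u + v - 1` in units of `b`, is remeasured in
    -- units of `1 - b`; the change of unit is the odds `θ`, whence the need for `scale_le`.
    · have e : b * (u + v) = b + (1 - b) * (θ * (u + v - 1)) := by
        linear_combination (1 - u - v) * hθb
      rw [e, lexStep_add hb0 hb1 hf.map_zero hf.map_one (by nlinarith)]
      have h1 := hf.add_le_wrap u v hu1 hv1 h
      have h2 := hP (u + v - 1) (by linarith) (by linarith)
      calc a * f u + a * f v = a * (f u + f v) := by ring
        _ ≤ a * (1 + f (u + v - 1)) := by gcongr
        _ = a + (1 - a) * (κ * f (u + v - 1)) := by linear_combination -f (u + v - 1) * hκa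
        _ ≤ _ := by gcongr
  -- Here `y ≤ b ≤ x ≤ y`, so both points equal `b`.
  · have h1 : b ≤ b * v := by nlinarith
    have h2 : v = 1 := le_antisymm hv1 (by nlinarith)
    have h3 : u = 0 := by nlinarith
    subst h2 h3
    have e1 : b + (1 - b) * 0 = b * 1 := by ring
    have e2 : b * 1 + b * 1 = b + (1 - b) * θ := by linear_combination -hθb
    rw [e1, e2, lexStep_add hb0 hb1 hf.map_zero hf.map_one hθ0.le, lexStep_mul hb0 f le_rfl,
      hf.map_one]
    nlinarith
  · rw [lexStep_mul hb0 f hu1]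
    have e : b * u + (b + (1 - b) * v) = b + (1 - b) * (θ * u + v) := by
      linear_combination -u * hθb
    have hs' : θ * u + v ≤ 1 := by nlinarith
    have hθu : 0 ≤ θ * u := by positivity
    rw [e, lexStep_add hb0 hb1 hf.map_zero hf.map_one hv0,
      lexStep_add hb0 hb1 hf.map_zero hf.map_one (by linarith)]
    have h1 := hf.add_le _ _ hθu hv0 hs'
    have h2 := hP u hu0 hu1
    calc a * f u + (a + (1 - a) * f v) = a + (1 - a) * (κ * f u + f v) := by
          linear_combination -f u * hκa
      _ ≤ _ := by gcongr; linarith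
  · have e : b + (1 - b) * u + (b + (1 - b) * v) = b + (1 - b) * (θ + (u + v)) := by
      linear_combination -hθb
    have hs' : θ + (u + v) ≤ 1 := by nlinarith
    rw [e, lexStep_add hb0 hb1 hf.map_zero hf.map_one hv0,
      lexStep_add hb0 hb1 hf.map_zero hf.map_one hu0,
      lexStep_add hb0 hb1 hf.map_zero hf.map_one (by linarith)]
    have h1 := hf.add_le _ _ hθ0.le (by linarith : 0 ≤ u + v) hs'
    have h2 := hf.add_le _ _ hu0 hv0 (by linarith)
    calc _ = a + (1 - a) * (κ + (f u + f v)) := by linear_combination -hκa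
      _ ≤ _ := by gcongr; linarith

lemma lexStep_add_le_wrap (hf : IsLexProfile a b f) (ha : 0 < a) (hab : a < b) (hb : b < 1 / 2)
    {x y : ℝ} (hxy : x ≤ y) (hy : y ≤ 1) (hs : 1 ≤ x + y) :
    lexStep a b f x + lexStep a b f y ≤ 1 + lexStep a b f (x + y - 1) := by
  have hb0 : 0 < b := ha.trans hab
  have hb1 : b < 1 := by linarith
  have ha' : 0 < 1 - a := by linarith
  have hb' : 0 < 1 - b := by linarith
  obtain ⟨θ, hθ⟩ : ∃ θ, b / (1 - b) = θ := ⟨_, rfl⟩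
  obtain ⟨κ, hκ⟩ : ∃ κ, a / (1 - a) = κ := ⟨_, rfl⟩
  have hD := hf.compl_scale_le
  rw [hθ, hκ] at hD
  have hθb : θ * (1 - b) = b := by rw [← hθ]; field_simp
  have hκa : κ * (1 - a) = a := by rw [← hκ]; field_simp
  have hθ0 : 0 < θ := hθ ▸ div_pos hb0 hb'
  have hθ1 : θ < 1 := by rw [← hθ, div_lt_one hb']; linarith
  have hκ0 : 0 < κ := hκ ▸ div_pos ha ha'
  have hyb : b < y := by linarith
  obtain ⟨v, hv0, hv1, rfl⟩ : ∃ t, 0 ≤ t ∧ t ≤ 1 ∧ y = b + (1 - b) * t := by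
    rcases exists_lex_split hb0 hb1 (by linarith : 0 ≤ y) hy with ⟨v, hv0, hv1, rfl⟩ | h
    · nlinarith
    · exact h
  rcases exists_lex_split hb0 hb1 (by linarith : 0 ≤ x) (by linarith) with
    ⟨u, hu0, hu1, rfl⟩ | ⟨u, hu0, hu1, rfl⟩
  -- The deficit `1 - v` of `y`, in units of `1 - b`, is `(1 - v) / θ` in units of `b`; so `x + y -
  -- 1 = b * z`.
  · obtain ⟨z, hz⟩ : ∃ z, z = u - (1 - v) / θ := ⟨_, rfl⟩
    have hz' : θ * (u - z) = 1 - v := by rw [hz]; field_simp; ring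
    have e : b * u + (b + (1 - b) * v) - 1 = b * z := by
      linear_combination (1 - b) * hz' - (u - z) * hθb
    have hz0 : 0 ≤ z := by nlinarith
    have hzu : z ≤ u := by nlinarith
    rw [e, lexStep_mul hb0 f hu1, lexStep_mul hb0 f (by linarith),
      lexStep_add hb0 hb1 hf.map_zero hf.map_one hv0]
    have h1 := hf.add_le_wrap u (1 - (u - z)) hu1 (by linarith) (by linarith)
    have h2 := hD (u - z) (by linarith) (by linarith)
    rw [show u + (1 - (u - z)) - 1 = z by ring] at h1
    rw [show 1 - θ * (u - z) = v by linarith] at h2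
    have h3 : κ * (f u - f z) ≤ 1 - f v := 
      (mul_le_mul_of_nonneg_left (by linarith) hκ0.le).trans h2
    calc a * f u + (a + (1 - a) * f v)
        = a * f z + a + (1 - a) * (κ * (f u - f z) + f v) := by
          linear_combination (f z - f u) * hκa
      _ ≤ a * f z + a + (1 - a) * 1 := by gcongr; linarith
      _ = _ := by ring
  · rw [lexStep_add hb0 hb1 hf.map_zero hf.map_one hv0,
      lexStep_add hb0 hb1 hf.map_zero hf.map_one hu0]
    rcases le_total 1 (u + v) with h | h
    · have e : b + (1 - b) * u + (b + (1 - b) * v) - 1 = b + (1 - b) * (u + v - 1) := by ring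
      rw [e, lexStep_add hb0 hb1 hf.map_zero hf.map_one (by linarith)]
      nlinarith [hf.add_le_wrap u v hu1 hv1 h]
    · obtain ⟨z, hz⟩ : ∃ z, z = 1 - (1 - (u + v)) / θ := ⟨_, rfl⟩
      have hz' : θ * (1 - z) = 1 - (u + v) := by rw [hz]; field_simp; ring
      have e : b + (1 - b) * u + (b + (1 - b) * v) - 1 = b * z := by
        linear_combination (1 - b) * hz' - (1 - z) * hθb
      have hz0 : 0 ≤ z := by nlinarith
      have hz1 : z ≤ 1 := by nlinarith
      rw [e, lexStep_mul hb0 f hz1]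
      have h1 := hf.add_le u v hu0 hv0 h
      have h2 := hD (1 - z) (by linarith) (by linarith)
      rw [show 1 - θ * (1 - z) = u + v by linarith, sub_sub_cancel] at h2
      calc _ = 2 * a + (1 - a) * (f u + f v) := by ring
        _ ≤ 2 * a + (1 - a) * (1 - κ * (1 - f z)) := by gcongr; linarith
        _ = _ := by linear_combination (f z - 1) * hκa

lemma lexStep_scale_le (hf : IsLexProfile a b f) (ha : 0 < a) (hab : a < b) (hb : b < 1 / 2)
    {w : ℝ} (hw0 : 0 ≤ w) (hw1 : w ≤ 1) :
    a / (1 - a) * lexStep a b f w ≤ lexStep a b f (b / (1 - b) * w) := by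
  have hb0 : 0 < b := ha.trans hab
  have hb1 : b < 1 := by linarith
  have ha' : 0 < 1 - a := by linarith
  have hb' : 0 < 1 - b := by linarith
  have hP := hf.scale_le
  obtain ⟨θ, hθ⟩ : ∃ θ, b / (1 - b) = θ := ⟨_, rfl⟩
  obtain ⟨κ, hκ⟩ : ∃ κ, a / (1 - a) = κ := ⟨_, rfl⟩
  rw [hθ, hκ] at hP ⊢
  have hθb : θ * (1 - b) = b := by rw [← hθ]; field_simp
  have hκa : κ * (1 - a) = a := by rw [← hκ]; field_simp
  have hθ0 : 0 < θ := hθ ▸ div_pos hb0 hb'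
  have hθ1 : θ < 1 := by rw [← hθ, div_lt_one hb']; linarith
  have hκθ := hP 1 zero_le_one le_rfl
  rw [hf.map_one, mul_one, mul_one] at hκθ
  rcases exists_lex_split hb0 hb1 hw0 hw1 with ⟨r, hr0, hr1, rfl⟩ | ⟨r, hr0, hr1, rfl⟩
  · rw [lexStep_mul hb0 f hr1, mul_left_comm θ, lexStep_mul hb0 f (by nlinarith)]
    nlinarith [hP r hr0 hr1]
  · rw [lexStep_add hb0 hb1 hf.map_zero hf.map_one hr0]
    have e0 : κ * (a + (1 - a) * f r) = a * (κ + f r) := by linear_combination f r * hκa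
    have e : θ * (b + (1 - b) * r) = b * (θ + r) := by linear_combination r * hθb
    rw [e0, e]
    rcases le_total (θ + r) 1 with h | h
    · rw [lexStep_mul hb0 f h]
      have h1 := hf.add_le θ r hθ0.le hr0 h
      gcongr
      linarith
    · have e' : b * (θ + r) = b + (1 - b) * (θ * (θ + r - 1)) := by
        linear_combination (1 - θ - r) * hθb
      rw [e', lexStep_add hb0 hb1 hf.map_zero hf.map_one (mul_nonneg hθ0.le (by linarith))]
      have h1 := hf.add_le_wrap θ r hθ1.le hr1 h
      have h2 := hP (θ + r - 1) (by linarith) (by linarith)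
      calc a * (κ + f r) ≤ a * (1 + f (θ + r - 1)) :=
            mul_le_mul_of_nonneg_left (by linarith) ha.le
        _ = a + (1 - a) * (κ * f (θ + r - 1)) := by linear_combination -f (θ + r - 1) * hκa
        _ ≤ _ := by gcongr

lemma lexStep_compl_scale_le (hf : IsLexProfile a b f) (ha : 0 < a) (hab : a < b)
    (hb : b < 1 / 2) {d : ℝ} (hd0 : 0 ≤ d) (hd1 : d ≤ 1) :
    a / (1 - a) * (1 - lexStep a b f (1 - d)) ≤ 1 - lexStep a b f (1 - b / (1 - b) * d) := by
  have hb0 : 0 < b := ha.trans hab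
  have hb1 : b < 1 := by linarith
  have ha' : 0 < 1 - a := by linarith
  have hb' : 0 < 1 - b := by linarith
  have hP := hf.scale_le 1 zero_le_one le_rfl
  have hD := hf.compl_scale_le
  obtain ⟨θ, hθ⟩ : ∃ θ, b / (1 - b) = θ := ⟨_, rfl⟩
  obtain ⟨κ, hκ⟩ : ∃ κ, a / (1 - a) = κ := ⟨_, rfl⟩
  rw [hθ, hκ] at hD hP ⊢
  rw [hf.map_one, mul_one, mul_one] at hP
  have hθb : θ * (1 - b) = b := by rw [← hθ]; field_simp
  have hκa : κ * (1 - a) = a := by rw [← hκ]; field_simp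
  have hθ0 : 0 < θ := hθ ▸ div_pos hb0 hb'
  have hθ1 : θ < 1 := by rw [← hθ, div_lt_one hb']; linarith
  have hκ0 : 0 < κ := hκ ▸ div_pos ha ha'
  -- rescaling a final segment of length `1 + d`
  have hD' : ∀ d, 0 ≤ d → d ≤ 1 → θ + θ * d ≤ 1 →
      κ + κ * (1 - f (1 - d)) ≤ 1 - f (1 - (θ + θ * d)) := by
    intro d hd0 hd1 h
    have h1 := hf.add_le (1 - (θ + θ * d)) θ (by linarith) hθ0.le (by nlinarith)
    rw [show 1 - (θ + θ * d) + θ = 1 - θ * d by ring] at h1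
    linarith [hD d hd0 hd1]
  rcases exists_lex_split hb0 hb1 (by linarith : 0 ≤ 1 - d) (by linarith) with
    ⟨r, hr0, hr1, hr⟩ | ⟨r, hr0, hr1, hr⟩
  · obtain rfl : d = 1 - b * r := by linarith
    rw [hr, lexStep_mul hb0 f hr1]
    have hDr := hD (1 - r) (by linarith) (by linarith)
    rw [sub_sub_cancel] at hDr
    have hθr : 0 ≤ θ * (1 - r) := mul_nonneg hθ0.le (by linarith)
    have hθr1 : θ * (1 - r) ≤ 1 := by nlinarith
    rcases le_total (θ + θ * (θ * (1 - r))) 1 with h | h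
    · have e : 1 - θ * (1 - b * r) = b + (1 - b) * (1 - (θ + θ * (θ * (1 - r)))) := by
        linear_combination θ * (1 - r) * hθb
      rw [e, lexStep_add hb0 hb1 hf.map_zero hf.map_one (by linarith)]
      have h1 := hD' (θ * (1 - r)) hθr hθr1 h
      have h2 : κ * (κ * (1 - f r)) ≤ κ * (1 - f (1 - θ * (1 - r))) := by gcongr
      calc κ * (1 - a * f r) = (1 - a) * (κ + κ * (κ * (1 - f r))) := by
            linear_combination -κ * (1 - f r) * hκa
        _ ≤ (1 - a) * (1 - f (1 - (θ + θ * (θ * (1 - r))))) := by gcongr; linarith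
        _ = _ := by ring
    -- The rescaled final segment reaches below `b`: `g` is the length of that lower part in units
    -- of `b`, and `p = θ * (1 - r) - g` is the share for which `θ + θ * p = 1` exactly fills the
    -- block above `b`.
    · obtain ⟨g, hg⟩ : ∃ g, g = 1 + θ * (1 - r) - 1 / θ := ⟨_, rfl⟩
      have hgθ : θ * g = θ + θ * (θ * (1 - r)) - 1 := by rw [hg]; field_simp
      have hg0 : 0 ≤ g := by nlinarith
      have hg1 : g ≤ θ * (1 - r) := by nlinarith
      have e : 1 - θ * (1 - b * r) = b * (1 - g) := by
        linear_combination (1 - b) * hgθ + (θ * (1 - r) - g) * hθb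
      rw [e, lexStep_mul hb0 f (by linarith)]
      obtain ⟨p, hp⟩ : ∃ p, p = θ * (1 - r) - g := ⟨_, rfl⟩
      have hpθ : θ + θ * p = 1 := by rw [hp]; linear_combination -hgθ
      have hp1 : p ≤ 1 := by linarith
      have h1 := hD' p (by linarith) hp1 hpθ.le
      rw [hpθ, sub_self, hf.map_zero] at h1
      have h2 := hf.add_le_wrap (1 - g) (1 - p) (by linarith) (by linarith) (by linarith)
      rw [show 1 - g + (1 - p) - 1 = 1 - θ * (1 - r) by rw [hp]; ring] at h2
      have h3 : κ * (κ * (1 - f r)) ≤ κ * (1 - f (1 - θ * (1 - r))) := by gcongr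
      have h4 : κ * (1 - f (1 - θ * (1 - r))) ≤ κ * (1 - f (1 - g) + (1 - f (1 - p))) := by
        gcongr; linarith
      calc κ * (1 - a * f r) = (1 - a) * (κ + κ * (κ * (1 - f r))) := by
            linear_combination -κ * (1 - f r) * hκa
        _ ≤ (1 - a) * (1 + κ * (1 - f (1 - g))) :=
            mul_le_mul_of_nonneg_left (by linarith) ha'.le
        _ = _ := by linear_combination (1 - f (1 - g)) * hκa
  · obtain rfl : d = (1 - b) * (1 - r) := by linarith
    have e : 1 - θ * ((1 - b) * (1 - r)) = b + (1 - b) * (1 - θ * (1 - r)) := by ring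
    have h0 := hD (1 - r) (by linarith) (by linarith)
    rw [sub_sub_cancel] at h0
    rw [hr, e, lexStep_add hb0 hb1 hf.map_zero hf.map_one hr0,
      lexStep_add hb0 hb1 hf.map_zero hf.map_one (by nlinarith)]
    nlinarith

/-- In the mixed case `x ≤ b ≤ y` the averaged point depends on `u + v` alone. Superadditivity,
plain or wrapped, merges `f u + f v`, and the two-point inequality for `f` is then used with an
endpoint: `(u + v, 1)` or `(0, u + v - 1)`. -/
lemma lexStep_two_point (hf : IsLexProfile a b f) (ha : 0 < a) (hab : a < b) (hb : b < 1 / 2)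
    {x y : ℝ} (hx : 0 ≤ x) (hxy : x ≤ y) (hy : y ≤ 1) :
    (1 - a) * lexStep a b f x + a * lexStep a b f y ≤
      lexStep a b f ((1 - b) * x + b * y) := by
  have hb0 : 0 < b := ha.trans hab
  have hb1 : b < 1 := by linarith
  have ha' : 0 < 1 - a := by linarith
  have hb' : 0 < 1 - b := by linarith
  rcases exists_lex_split hb0 hb1 hx (hxy.trans hy) with
    ⟨u, hu0, hu1, rfl⟩ | ⟨u, hu0, hu1, rfl⟩ <;>
  rcases exists_lex_split hb0 hb1 (hx.trans hxy) hy with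
    ⟨v, hv0, hv1, rfl⟩ | ⟨v, hv0, hv1, rfl⟩
  · have e : (1 - b) * (b * u) + b * (b * v) = b * ((1 - b) * u + b * v) := by ring
    rw [e, lexStep_mul hb0 f hu1, lexStep_mul hb0 f hv1, lexStep_mul hb0 f (by nlinarith)]
    nlinarith [hf.two_point u v hu0 (by nlinarith) hv1]
  · rw [lexStep_mul hb0 f hu1, lexStep_add hb0 hb1 hf.map_zero hf.map_one hv0]
    rcases le_total (u + v) 1 with h | h
    · have e : (1 - b) * (b * u) + b * (b + (1 - b) * v) = b * (b + (1 - b) * (u + v)) := by ring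
      have h1 : b + (1 - b) * (u + v) ≤ 1 := by nlinarith
      have h2 := hf.add_le u v hu0 hv0 h
      have h3 := hf.two_point (u + v) 1 (by linarith) h le_rfl
      rw [hf.map_one, mul_one, mul_one] at h3
      rw [e, lexStep_mul hb0 f h1]
      calc _ = a * ((1 - a) * (f u + f v) + a) := by ring
        _ ≤ a * ((1 - a) * f (u + v) + a) := by gcongr
        _ ≤ a * f ((1 - b) * (u + v) + b) := by gcongr
        _ = _ := by rw [add_comm b]
    · have e : (1 - b) * (b * u) + b * (b + (1 - b) * v)
          = b + (1 - b) * (b * (u + v - 1)) := by ring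
      have h2 := hf.add_le_wrap u v hu1 hv1 h
      have h3 := hf.two_point 0 (u + v - 1) le_rfl (by linarith) (by linarith)
      rw [hf.map_zero, mul_zero, mul_zero, zero_add, zero_add] at h3
      rw [e, lexStep_add hb0 hb1 hf.map_zero hf.map_one (mul_nonneg hb0.le (by linarith))]
      calc _ = a * a + (1 - a) * (a * (f u + f v)) := by ring
        _ ≤ a * a + (1 - a) * (a * (1 + f (u + v - 1))) := by gcongr
        _ = a + (1 - a) * (a * f (u + v - 1)) := by ring
        _ ≤ _ := by gcongr
  · have h1 : b ≤ b * v := by nlinarith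
    have h2 : v = 1 := le_antisymm hv1 (by nlinarith)
    have h3 : u = 0 := by nlinarith
    subst h2 h3
    have e1 : b + (1 - b) * 0 = b * 1 := by ring
    rw [e1, ← add_mul, sub_add_cancel, one_mul, ← add_mul, sub_add_cancel, one_mul]
  · have e : (1 - b) * (b + (1 - b) * u) + b * (b + (1 - b) * v)
        = b + (1 - b) * ((1 - b) * u + b * v) := by ring
    rw [e, lexStep_add hb0 hb1 hf.map_zero hf.map_one hu0,
      lexStep_add hb0 hb1 hf.map_zero hf.map_one hv0,
      lexStep_add hb0 hb1 hf.map_zero hf.map_one (by positivity)]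
    nlinarith [hf.two_point u v hu0 (by nlinarith) hv1]

protected lemma lexStep (hf : IsLexProfile a b f) (ha : 0 < a) (hab : a < b) (hb : b < 1 / 2) :
    IsLexProfile a b (lexStep a b f) where
  map_zero := by
    simpa [hf.map_zero] using lexStep_mul (a := a) (ha.trans hab) f zero_le_one
  map_one := by
    simpa [hf.map_one] using lexStep_add (a := a) (ha.trans hab) (by linarith)
      hf.map_zero hf.map_one zero_le_one
  add_le x y hx hy hs := by
    rcases le_total x y with h | h
    · exact hf.lexStep_add_le ha hab hb hx h hs
    · rw [add_comm, add_comm x]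
      exact hf.lexStep_add_le ha hab hb hy h (by linarith)
  add_le_wrap x y hx hy hs := by
    rcases le_total x y with h | h
    · exact hf.lexStep_add_le_wrap ha hab hb h hy hs
    · rw [add_comm, add_comm x]
      exact hf.lexStep_add_le_wrap ha hab hb h hx (by linarith)
  scale_le _ h0 h1 := hf.lexStep_scale_le ha hab hb h0 h1
  compl_scale_le _ h0 h1 := hf.lexStep_compl_scale_le ha hab hb h0 h1
  two_point _ _ hx hxy hy := hf.lexStep_two_point ha hab hb hx hxy hy

end IsLexProfile

/-! ### The odds-ratio profile as the starting point. -/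

section OddsProfile

variable {a b : ℝ}

lemma oddsProfile_denom_pos (ha : 0 < a) (hab : a < b) (hb : b < 1) {x : ℝ} (hx : x ≤ 1) :
    0 < b * (1 - a) - (b - a) * x := by
  nlinarith [mul_nonneg (sub_nonneg.2 hab.le) (sub_nonneg.2 hx), mul_pos ha (sub_pos.2 hb)]

/-- With this form the conditions near 1 follow, like those near 0, from the denominator being
decreasing in `x`. -/
lemma one_sub_oddsProfile (ha : 0 < a) (hab : a < b) (hb : b < 1) {x : ℝ} (hx : x ≤ 1) :
    1 - oddsProfile a b x = b * (1 - a) * ((1 - x) / (b * (1 - a) - (b - a) * x)) := by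
  have hD := (oddsProfile_denom_pos ha hab hb hx).ne'
  rw [oddsProfile]
  generalize hD' : b * (1 - a) - (b - a) * x = D at *
  field_simp
  rw [← hD']
  ring

/-- The profile is an increasing affine function of the reciprocal of its denominator, and the
denominator is affine in `x`; only an inequality between reciprocals of `X` and `Y` remains. -/
lemma oddsProfile_two_point (ha : 0 < a) (hab : a < b) (hb : b < 1) {x y : ℝ} (hx : 0 ≤ x)
    (hxy : x ≤ y) (hy : y ≤ 1) :
    (1 - a) * oddsProfile a b x + a * oddsProfile a b y ≤
      oddsProfile a b ((1 - b) * x + b * y) := by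
  have hX := oddsProfile_denom_pos ha hab hb (hxy.trans hy)
  have hY := oddsProfile_denom_pos ha hab hb hy
  have hba : 0 < b - a := sub_pos.2 hab
  have hZ : b * (1 - a) - (b - a) * ((1 - b) * x + b * y) =
      (1 - b) * (b * (1 - a) - (b - a) * x) + b * (b * (1 - a) - (b - a) * y) := by ring
  have key : ∀ t, 0 < b * (1 - a) - (b - a) * t → oddsProfile a b t =
      a * (1 - b) / (b - a) * (b * (1 - a) * (b * (1 - a) - (b - a) * t)⁻¹ - 1) := by
    intro t ht
    rw [oddsProfile]
    generalize hD : b * (1 - a) - (b - a) * t = D at *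
    field_simp
    rw [← hD]
    ring
  have hZ0 : 0 < b * (1 - a) - (b - a) * ((1 - b) * x + b * y) :=
    oddsProfile_denom_pos ha hab hb (by nlinarith)
  rw [key x hX, key y hY, key _ hZ0, hZ]
  rw [hZ] at hZ0
  have hXY : b * (1 - a) - (b - a) * x = b * (1 - a) - (b - a) * y + (b - a) * (y - x) := by ring
  have hYt : a * (1 - b) * (y - x) ≤ b * (1 - a) - (b - a) * y := by
    nlinarith [mul_nonneg hba.le (sub_nonneg.2 hy), mul_pos ha (sub_pos.2 hb)]
  generalize b * (1 - a) - (b - a) * x = X at *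
  generalize b * (1 - a) - (b - a) * y = Y at *
  have main : (1 - a) * X⁻¹ + a * Y⁻¹ ≤ ((1 - b) * X + b * Y)⁻¹ := by
    have e : (1 - a) * X⁻¹ + a * Y⁻¹ = ((1 - a) * Y + a * X) / (X * Y) := by field_simp
    rw [e, ← one_div, div_le_div_iff₀ (mul_pos hX hY) hZ0, hXY]
    -- With `X = Y + (b - a) * (y - x)`, the difference of the cross-multiplied sides is exactly
    -- this product.
    have := mul_nonneg (mul_nonneg hba.le (sub_nonneg.2 hxy))
      (mul_nonneg hba.le (sub_nonneg.2 hYt))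
    nlinarith
  have hc : 0 ≤ a * (1 - b) / (b - a) := div_nonneg (mul_nonneg ha.le (by linarith)) hba.le
  have hq : 0 ≤ b * (1 - a) := mul_nonneg (by linarith) (by linarith)
  calc _ = a * (1 - b) / (b - a) * (b * (1 - a) * ((1 - a) * X⁻¹ + a * Y⁻¹) - 1) := by ring
    _ ≤ _ := by gcongr

lemma isLexProfile_oddsProfile (ha : 0 < a) (hab : a < b) (hb : b < 1 / 2) :
    IsLexProfile a b (oddsProfile a b) := by
  have hb1 : b < 1 := by linarith
  have hb0 : 0 < b := ha.trans hab
  have hba : 0 < b - a := sub_pos.2 hab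
  have ha' : 0 < 1 - a := by linarith
  have hb' : 0 < 1 - b := by linarith
  have hpos := fun {x : ℝ} (hx : x ≤ 1) => oddsProfile_denom_pos ha hab hb1 hx
  have hc : 0 < a * (1 - b) := mul_pos ha hb'
  have hκθ : a / (1 - a) ≤ b / (1 - b) := by
    rw [div_le_div_iff₀ ha' hb']; nlinarith
  have hθ1 : b / (1 - b) ≤ 1 := by rw [div_le_one hb']; linarith
  have hθ0 : 0 < b / (1 - b) := div_pos hb0 hb'
  refine ⟨by simp [oddsProfile], ?_, ?_, ?_, ?_, ?_,
    fun x y hx hxy hy => oddsProfile_two_point ha hab hb1 hx hxy hy⟩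
  · rw [oddsProfile, mul_one, mul_one, show b * (1 - a) - (b - a) = a * (1 - b) by ring,
      div_self hc.ne']
  · intro x y hx hy hs
    have := hpos hs
    rw [oddsProfile, oddsProfile, oddsProfile, mul_add (a * (1 - b)), add_div]
    gcongr <;> linarith
  · intro x y hx hy hs
    have h1 := one_sub_oddsProfile ha hab hb1 hx
    have h2 := one_sub_oddsProfile ha hab hb1 hy
    have h3 := one_sub_oddsProfile ha hab hb1 (by linarith : x + y - 1 ≤ 1)
    have hx1 : 0 ≤ 1 - x := by linarith
    have hy1 : 0 ≤ 1 - y := by linarith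
    have hX := hpos hx
    have hY := hpos hy
    have h4 : (1 - (x + y - 1)) / (b * (1 - a) - (b - a) * (x + y - 1)) ≤
        (1 - x) / (b * (1 - a) - (b - a) * x) + (1 - y) / (b * (1 - a) - (b - a) * y) := by
      rw [show 1 - (x + y - 1) = (1 - x) + (1 - y) by ring, add_div]
      gcongr <;> linarith
    have h5 := mul_le_mul_of_nonneg_left h4 (mul_pos hb0 ha').le
    linarith
  · intro w hw0 hw1
    have hw2 : b / (1 - b) * w ≤ 1 := by nlinarith
    rw [oddsProfile, oddsProfile, ← mul_div_assoc, div_le_div_iff₀ (hpos hw1) (hpos hw2)]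
    have e1 : a / (1 - a) * (b * (1 - a)) = a * b := by field_simp
    have e2 : b / (1 - b) * (a * (1 - b)) = a * b := by field_simp
    have h1 : a / (1 - a) * (b * (1 - a) - (b - a) * (b / (1 - b) * w)) ≤
        b / (1 - b) * (b * (1 - a) - (b - a) * w) := by
      have h2 : 0 ≤ a / (1 - a) * ((b - a) * (b / (1 - b) * w)) := by positivity
      have h3 : 0 ≤ b / (1 - b) * ((b - a) * (1 - w)) :=
        mul_nonneg hθ0.le (mul_nonneg hba.le (by linarith))
      linear_combination h2 + h3 + e1 - e2
    have h2 := mul_le_mul_of_nonneg_left h1 (mul_nonneg hc.le hw0)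
    linear_combination h2
  · intro d hd0 hd1
    have hθd : b / (1 - b) * d ≤ d := by nlinarith
    have hθd0 : 0 ≤ b / (1 - b) * d := by positivity
    rw [one_sub_oddsProfile ha hab hb1 (by linarith),
      one_sub_oddsProfile ha hab hb1 (by linarith), sub_sub_cancel, sub_sub_cancel,
      mul_left_comm, ← mul_div_assoc]
    have := hpos (by linarith : 1 - b / (1 - b) * d ≤ 1)
    gcongr

/-! ### Iterated profiles and the product inequality. -/

lemma isLexProfile_iterate (ha : 0 < a) (hab : a < b) (hb : b < 1 / 2) (N : ℕ) :
    IsLexProfile a b ((lexStep a b)^[N] (oddsProfile a b)) := by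
  induction N with
  | zero => exact isLexProfile_oddsProfile ha hab hb
  | succ N ih =>
    rw [Function.iterate_succ_apply']
    exact ih.lexStep ha hab hb

lemma lexStep_iterate_pow_mul (hb0 : 0 < b) (hb1 : b < 1) (f : ℝ → ℝ) {u : ℝ} (hu0 : 0 ≤ u)
    (hu : u ≤ 1) (k : ℕ) : (lexStep a b)^[k] f (b ^ k * u) = a ^ k * f u := by
  induction k with
  | zero => simp
  | succ k ih =>
    have h : b ^ k * u ≤ 1 := mul_le_one₀ (pow_le_one₀ hb0.le hb1.le) hu0 hu
    rw [Function.iterate_succ_apply', pow_succ', mul_assoc, lexStep_mul hb0 _ h, ih]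
    ring

/-- The product inequality for the profile inside one block `b ^ (k + 1) ≤ s ≤ b ^ k`, where
`K = a ^ k` and `q = b ^ k`, follows from its validity at the two ends of the block. -/
lemma block_inequality (ha : 0 < a) (hab : a < b) (hb : b < 1 / 2) {K q : ℝ} (hK : 0 < K)
    (hq : 0 < q) (h0 : (1 - a) * K * (1 - q) ≤ a * q)
    (h1 : (1 - a) * K * (1 - q * b) ≤ q * b) {r : ℝ} (hr0 : 0 ≤ r) (hr1 : r ≤ 1) :
    (1 - a) * (K * (a + (1 - a) * oddsProfile a b r)) * (1 - q * (b + (1 - b) * r)) ≤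
      a * (q * (b + (1 - b) * r)) := by
  have hb1 : b < 1 := by linarith
  have ha' : 0 < 1 - a := by linarith
  have hb' : 0 < 1 - b := by linarith
  have hb0 : 0 < b := ha.trans hab
  have hD := oddsProfile_denom_pos ha hab hb1 hr1
  have hG : a + (1 - a) * oddsProfile a b r =
      a * (b * (1 - a) + (1 - 2 * b + a * b) * r) / (b * (1 - a) - (b - a) * r) := by
    rw [oddsProfile]
    generalize hD' : b * (1 - a) - (b - a) * r = D at *
    field_simp
    rw [← hD']
    ring
  have hE : 0 < 1 - 2 * b + a * b := by nlinarith
  suffices h : (1 - a) * K * (b * (1 - a) + (1 - 2 * b + a * b) * r) *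
      (1 - q * (b + (1 - b) * r)) ≤
      q * (b + (1 - b) * r) * (b * (1 - a) - (b - a) * r) by
    rw [hG, show (1 - a) * (K * (a * (b * (1 - a) + (1 - 2 * b + a * b) * r) /
      (b * (1 - a) - (b - a) * r))) * (1 - q * (b + (1 - b) * r)) =
      a * ((1 - a) * K * (b * (1 - a) + (1 - 2 * b + a * b) * r) *
      (1 - q * (b + (1 - b) * r))) / (b * (1 - a) - (b - a) * r) by ring, div_le_iff₀ hD]
    calc _ ≤ a * (q * (b + (1 - b) * r) * (b * (1 - a) - (b - a) * r)) := by gcongr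
      _ = _ := by ring
  obtain ⟨P, hP⟩ : ∃ P, P = (1 - a) * K := ⟨_, rfl⟩
  have hP0 : 0 < P := hP ▸ mul_pos ha' hK
  rw [← hP] at h0 h1 ⊢
  have e0 : 0 ≤ b * (1 - a) * (q * b - P * (1 - q * b)) :=
    mul_nonneg (mul_pos hb0 ha').le (by linarith)
  have e1 : 0 ≤ (1 - b) * (a * q - P * (1 - q)) := mul_nonneg hb'.le (by linarith)
  -- The difference of the two sides is a quadratic in `r`, equal to `e0` at 0 and `e1` at 1. If it
  -- is concave it lies above its chord; if convex, all its coefficients are nonnegative.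
  rcases le_total (P * (1 - 2 * b + a * b)) (b - a) with hc | hc
  · have e2 := mul_nonneg e0 (sub_nonneg.2 hr1)
    have e3 := mul_nonneg e1 hr0
    have e4 : 0 ≤ q * (1 - b) * (b - a - P * (1 - 2 * b + a * b)) * (r * (1 - r)) :=
      mul_nonneg (mul_nonneg (mul_pos hq hb').le (by linarith))
        (mul_nonneg hr0 (by linarith))
    linear_combination e2 + e3 + e4
  · have e3 : 0 ≤ (1 - 2 * b + a * b) * (q * b - P * (1 - q * b)) * r :=
      mul_nonneg (mul_nonneg hE.le (by linarith)) hr0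
    have e4 : 0 ≤ q * (1 - b) * (P * (1 - 2 * b + a * b) - (b - a)) * (r * r) :=
      mul_nonneg (mul_nonneg (mul_pos hq hb').le (by linarith)) (mul_self_nonneg r)
    have e5 : 0 ≤ P * q * (1 - b) * b * (1 - a) * r := by positivity
    linear_combination e0 + e3 + e4 + e5

lemma exists_iterate_mul_one_sub_le (ha : 0 < a) (hab : a < b) (hb : b < 1 / 2)
    (h : ∀ k : ℕ, (1 - a) * a ^ k * (1 - b ^ k) ≤ a * b ^ k) {m : ℝ} (hm1 : m ≤ 1) :
    ∃ N, (lexStep a b)^[N] (oddsProfile a b) m * (1 - m) ≤ a * (1 - b) := by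
  have hb1 : b < 1 := by linarith
  have hb' : 0 < 1 - b := by linarith
  have hb0 : 0 < b := ha.trans hab
  rcases le_or_gt m b with hmb | hmb
  -- Up to `b` the odds-ratio profile suffices: the inequality reduces to `(b - m) * (1 - a - m) ≥
  -- 0`.
  · refine ⟨0, ?_⟩
    have hD := oddsProfile_denom_pos ha hab hb1 hm1
    rw [Function.iterate_zero_apply, oddsProfile, div_mul_eq_mul_div, div_le_iff₀ hD, mul_assoc]
    have : 0 < a * (1 - b) := mul_pos ha hb'
    gcongr
    nlinarith [mul_nonneg (sub_nonneg.2 hmb) (by linarith : 0 ≤ 1 - a - m)]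
  · obtain ⟨s, hs⟩ : ∃ s, s = (m - b) / (1 - b) := ⟨_, rfl⟩
    have hms : m = b + (1 - b) * s := by rw [hs]; field_simp; ring
    have hs0 : 0 < s := hs ▸ div_pos (by linarith) hb'
    have hs1 : s ≤ 1 := by rw [hs, div_le_one hb']; linarith
    obtain ⟨k, hk, hk'⟩ := exists_nat_pow_near_of_lt_one hs0 hs1 hb0 hb1
    have hq : 0 < b ^ k := pow_pos hb0 k
    obtain ⟨r, hr⟩ : ∃ r, r = (s / b ^ k - b) / (1 - b) := ⟨_, rfl⟩
    have hsr : s = b ^ k * (b + (1 - b) * r) := by rw [hr]; field_simp; ring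
    have hbs : b < s / b ^ k := by rwa [lt_div_iff₀ hq, ← pow_succ']
    have hbs1 : s / b ^ k ≤ 1 := (div_le_one hq).2 hk'
    have hr0 : 0 ≤ r := hr ▸ div_nonneg (by linarith) hb'.le
    have hr1 : r ≤ 1 := by rw [hr, div_le_one hb']; linarith
    have h1 := h (k + 1)
    rw [pow_succ, pow_succ] at h1
    have h1' : (1 - a) * a ^ k * (1 - b ^ k * b) ≤ b ^ k * b := by
      refine le_of_mul_le_mul_left ?_ ha
      linarith
    have key := block_inequality ha hab hb (pow_pos ha k) hq (h k) h1' hr0 hr1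
    have hH := isLexProfile_oddsProfile ha hab hb
    have hI := isLexProfile_iterate ha hab hb (k + 1)
    -- One step leaves the first block (`m` to `s`), `k` steps strip the factor `b ^ k`, and one
    -- more passes from `b + (1 - b) * r` to `r`.
    refine ⟨k + 2, ?_⟩
    have e : (lexStep a b)^[k + 1] (oddsProfile a b) s =
        a ^ k * (a + (1 - a) * oddsProfile a b r) := by
      have hu : b + (1 - b) * r ≤ 1 := by nlinarith
      rw [hsr, Function.iterate_succ_apply, lexStep_iterate_pow_mul hb0 hb1 _ (by positivity) hu,
        lexStep_add hb0 hb1 hH.map_zero hH.map_one hr0]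
    rw [Function.iterate_succ_apply', hms,
      lexStep_add hb0 hb1 hI.map_zero hI.map_one hs0.le, e]
    rw [← hsr] at key
    have := mul_le_mul_of_nonneg_left key hb'.le
    linear_combination this

end OddsProfile

/-! ### Biased measures of monotone families and of the modified stars. -/

section BiasedSum

open Finset

variable {ι : Type*}

/-- The `p`-biased measure of the subsets of `S` that satisfy `U`. -/
noncomputable def biasedSum (p : ℝ) (S : Finset ι) (U : Finset ι → Prop) [DecidablePred U] : ℝ :=
  ∑ A ∈ S.powerset, if U A then p ^ #A * (1 - p) ^ (#S - #A) else 0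

lemma biasedSum_insert [DecidableEq ι] (p : ℝ) {S : Finset ι} {x : ι} (hx : x ∉ S) (U : Finset ι → Prop)
    [DecidablePred U] :
    biasedSum p (insert x S) U =
      (1 - p) * biasedSum p S U + p * biasedSum p S (fun A => U (insert x A)) := by
  rw [biasedSum, sum_powerset_insert hx, biasedSum, biasedSum, mul_sum, mul_sum]
  congr 1
  · refine sum_congr rfl fun A hA => ?_
    rw [card_insert_of_notMem hx, Nat.sub_add_comm (card_le_card (mem_powerset.1 hA)), pow_succ]
    split_ifs <;> ring
  · refine sum_congr rfl fun A hA => ?_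
    rw [card_insert_of_notMem hx, card_insert_of_notMem (fun h => hx (mem_powerset.1 hA h)),
      Nat.add_sub_add_right, pow_succ]
    split_ifs <;> ring

lemma biasedSum_mono {p : ℝ} (hp0 : 0 ≤ p) (hp1 : p ≤ 1) (S : Finset ι) {U V : Finset ι → Prop}
    [DecidablePred U] [DecidablePred V] (h : ∀ A, U A → V A) :
    biasedSum p S U ≤ biasedSum p S V := by
  refine sum_le_sum fun A _ => ?_
  have : 0 ≤ p ^ #A * (1 - p) ^ (#S - #A) :=
    mul_nonneg (pow_nonneg hp0 _) (pow_nonneg (by linarith) _)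
  by_cases hU : U A
  · simp [hU, h A hU]
  · rw [if_neg hU]
    split_ifs <;> simp [this]

lemma biasedSum_true (p : ℝ) (S : Finset ι) : biasedSum p S (fun _ => True) = 1 := by
  simp [biasedSum, sum_pow_mul_eq_add_pow]

lemma biasedSum_false (p : ℝ) (S : Finset ι) : biasedSum p S (fun _ => False) = 0 := by
  simp [biasedSum]

lemma biasedSum_nonneg {p : ℝ} (hp0 : 0 ≤ p) (hp1 : p ≤ 1) (S : Finset ι) (U : Finset ι → Prop)
    [DecidablePred U] : 0 ≤ biasedSum p S U :=
  (biasedSum_false p S).ge.trans (biasedSum_mono hp0 hp1 S fun _ => False.elim)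

lemma biasedSum_le_one {p : ℝ} (hp0 : 0 ≤ p) (hp1 : p ≤ 1) (S : Finset ι) (U : Finset ι → Prop)
    [DecidablePred U] : biasedSum p S U ≤ 1 :=
  (biasedSum_mono hp0 hp1 S fun _ _ => trivial).trans (biasedSum_true p S).le

/-- Passing to complements exchanges the biases `p` and `1 - p`. -/
lemma biasedSum_not_sdiff [DecidableEq ι] (p : ℝ) (S : Finset ι) (U : Finset ι → Prop) [DecidablePred U] :
    biasedSum (1 - p) S (fun A => ¬ U (S \ A)) = 1 - biasedSum p S U := by
  have h : biasedSum (1 - p) S (fun A => ¬ U (S \ A)) = biasedSum p S (fun A => ¬ U A) := by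
    refine sum_nbij' (S \ ·) (S \ ·) (by simp) (by simp)
      (fun A hA => by simpa using hA) (fun A hA => by simpa using hA) fun A hA => ?_
    have hA' := mem_powerset.1 hA
    have hc := card_sdiff_of_subset hA'
    have hle := card_le_card hA'
    rw [hc, Nat.sub_sub_self hle, sub_sub_cancel, mul_comm]
  rw [h, eq_sub_iff_add_eq, ← biasedSum_true p S, biasedSum, biasedSum, biasedSum,
    ← sum_add_distrib]
  refine sum_congr rfl fun A _ => ?_
  by_cases hU : U A <;> simp [hU]

/-- Among monotone families of given `b`-measure, the `a`-measure is bounded by any function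
with the two-point inequality. -/
lemma IsLexProfile.biasedSum_le [DecidableEq ι] {a b : ℝ} {f : ℝ → ℝ} (hf : IsLexProfile a b f) (ha : 0 ≤ a)
    (ha1 : a ≤ 1) (hb : 0 ≤ b) (hb1 : b ≤ 1) (S : Finset ι) (U : Finset ι → Prop)
    [DecidablePred U] (hU : ∀ A B, A ⊆ B → U A → U B) :
    biasedSum a S U ≤ f (biasedSum b S U) := by
  induction S using Finset.induction_on generalizing U with
  | empty =>
    by_cases h : U ∅ <;> simp [biasedSum, h, hf.map_zero, hf.map_one]
  | insert x S hx ih =>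
    rw [biasedSum_insert a hx, biasedSum_insert b hx]
    have h1 := ih U hU
    have h2 := ih (fun A => U (insert x A)) fun A B h => hU _ _ (insert_subset_insert x h)
    have h3 : (1 - a) * biasedSum a S U ≤ (1 - a) * f (biasedSum b S U) :=
      mul_le_mul_of_nonneg_left h1 (by linarith)
    have h4 := mul_le_mul_of_nonneg_left h2 ha
    -- Monotonicity of `U` orders the measures of the two slices, as `two_point` requires.
    exact (add_le_add h3 h4).trans (hf.two_point _ _ (biasedSum_nonneg hb hb1 S U)
      (biasedSum_mono hb hb1 S fun A hA => hU _ _ (subset_insert x A) hA)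
      (biasedSum_le_one hb hb1 S _))

lemma biasedMeasure_eq_biasedSum {n : ℕ} (p : ℝ) (F : Finset (Finset (Fin n))) :
    biasedMeasure p F = biasedSum p univ (· ∈ F) := by
  simp [biasedMeasure, biasedSum]

lemma biasedMeasure_star (p : ℝ) (n : ℕ) :
    biasedMeasure p (univ.filter fun A : Finset (Fin (n + 1)) => 0 ∈ A) = p := by
  have h : (univ : Finset (Fin (n + 1))) = insert 0 (univ.erase 0) := by simp
  rw [biasedMeasure_eq_biasedSum, h, biasedSum_insert p (notMem_erase 0 univ)]
  have h1 : biasedSum p (univ.erase (0 : Fin (n + 1)))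
      (· ∈ univ.filter fun A : Finset (Fin (n + 1)) => 0 ∈ A) = 0 := by
    refine sum_eq_zero fun A hA => if_neg fun h' => ?_
    exact notMem_erase 0 univ (mem_powerset.1 hA (mem_filter.1 h').2)
  have h2 := biasedSum_true p (univ.erase (0 : Fin (n + 1)))
  rw [h1]
  simp [h2]

lemma initSegment_self (n : ℕ) : initSegment n n = univ := by
  simp [initSegment]

lemma biasedMeasure_modifiedStarA (p : ℝ) (j : ℕ) :
    biasedMeasure p (modifiedStarA (j + 2) j) = p + p ^ (j + 1) * (1 - p) := by
  have e : modifiedStarA (j + 2) j =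
      (univ.filter fun A : Finset (Fin (j + 2)) => 0 ∈ A) ∪ {univ \ {0}} := by
    ext A; simp [modifiedStarA, initSegment_self, or_comm]
  rw [e, biasedMeasure, sum_union (by simp), ← biasedMeasure, biasedMeasure_star, sum_singleton,
    card_sdiff_of_subset (subset_univ _)]
  simp

lemma biasedMeasure_modifiedStarB (p : ℝ) (j : ℕ) :
    biasedMeasure p (modifiedStarB (j + 2) j) = p - p * (1 - p) ^ (j + 1) := by
  have e : modifiedStarB (j + 2) j =
      (univ.filter fun A : Finset (Fin (j + 2)) => 0 ∈ A) \ {{0}} := by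
    ext A; simp [modifiedStarB, initSegment_self]
  rw [e, eq_sub_iff_add_eq]
  have h := sum_sdiff (f := fun A : Finset (Fin (j + 2)) => p ^ #A * (1 - p) ^ (j + 2 - #A))
    (show {{0}} ⊆ univ.filter fun A : Finset (Fin (j + 2)) => 0 ∈ A by simp)
  rw [← biasedMeasure, sum_singleton, ← biasedMeasure, biasedMeasure_star] at h
  simpa using h

end BiasedSum

/-! ### The main theorem. -/

theorem theorem1 (α β : ℝ) (hαβ : (α, β) ∈ triangleOmega)
    (h : ∀ j : ℕ,
      biasedMeasure α (modifiedStarA (j + 2) j) * biasedMeasure β (modifiedStarB (j + 2) j)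
        < α * β)
    (n : ℕ) (hn : 1 ≤ n) :
    IsGreatest (crossProducts n α β) (α * β) := by
  obtain ⟨n, rfl⟩ : ∃ m, n = m + 1 := ⟨n - 1, by omega⟩
  obtain ⟨hα, hβ, hs⟩ := hαβ
  simp only at hα hβ hs
  constructor
  · refine ⟨Finset.univ.filter fun A => 0 ∈ A, Finset.univ.filter fun A => 0 ∈ A, ?_, ?_⟩
    · intro A hA B hB
      exact ⟨0, Finset.mem_inter.2 ⟨(Finset.mem_filter.1 hA).2, (Finset.mem_filter.1 hB).2⟩⟩
    · rw [biasedMeasure_star, biasedMeasure_star]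
  rintro _ ⟨F, G, hFG, rfl⟩
  obtain ⟨b, rfl⟩ : ∃ b, β = 1 - b := ⟨1 - β, by ring⟩
  have hab : α < b := by linarith
  have hb : b < 1 / 2 := by linarith
  have hb0 : 0 < b := hα.trans hab
  -- For `k = j + 1` this is the assumption on `A_j` and `B_j` divided by `1 - b`; for `k = 0` it is
  -- just `0 ≤ α`.
  have hyp : ∀ k : ℕ, (1 - α) * α ^ k * (1 - b ^ k) ≤ α * b ^ k := by
    rintro (_ | j)
    · simpa using hα.le
    · have hj := (h j).le
      rw [biasedMeasure_modifiedStarA, biasedMeasure_modifiedStarB, sub_sub_cancel] at hj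
      refine le_of_mul_le_mul_left (a := 1 - b) ?_ (by linarith)
      linear_combination hj
  classical
  let U : Finset (Fin (n + 1)) → Prop := fun A => ∃ B ∈ F, B ⊆ A
  have hU : ∀ A B, A ⊆ B → U A → U B := fun A B hAB ⟨C, hC, hCA⟩ => ⟨C, hC, hCA.trans hAB⟩
  have hF : biasedMeasure α F ≤ biasedSum α Finset.univ U := by
    rw [biasedMeasure_eq_biasedSum]
    exact biasedSum_mono hα.le (by linarith) _ fun A hA => ⟨A, hA, subset_rfl⟩
  have hG : biasedMeasure (1 - b) G ≤ 1 - biasedSum b Finset.univ U := by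
    rw [biasedMeasure_eq_biasedSum, ← biasedSum_not_sdiff]
    refine biasedSum_mono (by linarith) (by linarith) _ fun B hB => ?_
    rintro ⟨A, hA, hAB⟩
    obtain ⟨i, hi⟩ := hFG A hA B hB
    rw [Finset.mem_inter] at hi
    exact (Finset.mem_sdiff.1 (hAB hi.1)).2 hi.2
  have hG0 : 0 ≤ biasedMeasure (1 - b) G := by
    rw [biasedMeasure_eq_biasedSum]
    exact biasedSum_nonneg (by linarith) (by linarith) _ _
  have hm1 := biasedSum_le_one hb0.le (by linarith) Finset.univ U
  obtain ⟨N, hN⟩ := exists_iterate_mul_one_sub_le hα hab hb hyp hm1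
  have hprof := (isLexProfile_iterate hα hab hb N).biasedSum_le hα.le (by linarith) hb0.le
    (by linarith) Finset.univ U hU
  calc biasedMeasure α F * biasedMeasure (1 - b) G
      ≤ biasedSum α Finset.univ U * (1 - biasedSum b Finset.univ U) :=
        mul_le_mul hF hG hG0 (biasedSum_nonneg hα.le (by linarith) _ _)
    _ ≤ (lexStep α b)^[N] (oddsProfile α b) (biasedSum b Finset.univ U) *
        (1 - biasedSum b Finset.univ U) :=
        mul_le_mul_of_nonneg_right hprof (by linarith)
    _ ≤ _ := hN
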